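/- Let $\langle\mathcal S,\mathcal A,T,R,\gamma\rangle$ be a Markov decision process with finite state space $\mathcal S$, finite action space $\mathcal A$ containing a no-op action $\varnothing$, transition function $T$, reward function $R:\mathcal S\times\mathcal A\to\mathbb R$ and discount factor $\gamma\in[0,1)$. Let $\lambda\ge 0$ and let $R_1,\dots,R_k:\mathcal S\times\mathcal A\to\mathbb R$ be finitely many auxiliary reward functions. An agent interacts with the process: at step $n=0,1,2,\dots$ it is in state $s_n$, takes action $a_n$ and observes a successor $s'_n$ which, conditionally on the information $\mathcal F_n$ (a filtration, with $s'_n$ being $\mathcal F_{n+1}$-measurable) available once $a_n$ has been selected (including $s_n$ and $a_n$), has law $T(s_n,a_n)$. Actions may depend on the past in any way, and either $s_{n+1}=s'_n$ or the next state may be reset, as in episodic learning. It runs tabular Q-learning on all auxiliary rewards simultaneously: from arbitrary initial tables $Q^0_{R_i}$, $$Q^{n+1}_{R_i}(s_n,a_n)=Q^n_{R_i}(s_n,a_n)+\alpha_n\Big(R_i(s_n,a_n)+\gamma\max_{a'}Q^n_{R_i}(s'_n,a')-Q^n_{R_i}(s_n,a_n)\Big),$$ all other entries being unchanged. Assume that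 almost surely every state-action pair is tried infinitely often, and that the learning rates $\alpha_n\ge 0$ are $\mathcal F_n$-measurable and almost surely satisfy, for every $(s,a)$, $$\sum_{n:(s_n,a_n)=(s,a)}\alpha_n=\infty,\qquad \sum_{n:(s_n,a_n)=(s,a)}\alpha_n^2<\infty .$$ (In particular, the exploration policy may be any policy that is greedy in the limit of infinite exploration.) Put $\mathrm{Penalty}_n(s,a)=\sum_{i=1}^k|Q^n_{R_i}(s,a)-Q^n_{R_i}(s,\varnothing)|$, let $\mathrm{Scale}_n(s)$ be a normalization computed from the tables $Q^n_{R_1},\dots,Q^n_{R_k}$ (for example $\sum_i Q^n_{R_i}(s,\varnothing)$), and let $$R^n_{\mathrm{AUP}}(s,a)=R(s,a)-\lambda\,\frac{\mathrm{Penalty}_n(s,a)}{\mathrm{Scale}_n(s)} .$$ Suppose that, almost surely, for every $s$, $\mathrm{Scale}_n(s)$ converges as $n\to\infty$ to a limit $\mathrm{Scale}^*(s)>0$. Then, with probability $1$, for all $s,a$ the online AUP reward $R^n_{\mathrm{AUP}}(s,a)$ converges as $n\to\infty$; its limit is $$R^*_{\mathrm{AUP}}(s,a)=R(s,a)-\lambda\,\frac{\sum_{i=1}^k|Q^*_{R_i}(s,a)-Q^*_{R_i}(s,\varnothing)|}{\mathrm{Scale}^*(s)},$$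 where $Q^*_{R_i}$ is the optimal Q-function of $\langle\mathcal S,\mathcal A,T,R_i,\gamma\rangle$, i.e. the solution of $Q(s,a)=R_i(s,a)+\gamma\sum_{s'}T(s'\mid s,a)\max_{a'}Q(s',a')$. -/

import Mathlib

open MeasureTheory Filter Topology

namespace AUP

/-- The expected value of `f` at the successor state of `(s, a)`, for a finite state space. -/
noncomputable def expectNext {S A : Type*} [Fintype S] (T : S → A → PMF S) (s : S) (a : A)
    (f : S → ℝ) : ℝ :=
  ∑ s', (T s a s').toReal * f s'

/-- `q` is the optimal Q-function of the MDP `(S, A, T, r, γ)`, i.e. it solves the Bellman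
optimality equation (which has exactly one solution when `S`, `A` are finite, `A` is non-empty and
`0 ≤ γ < 1`). -/
def IsOptimalQ {S A : Type*} [Fintype S] (T : S → A → PMF S) (γ : ℝ) (r : S → A → ℝ)
    (q : S → A → ℝ) : Prop :=
  ∀ s a, q s a = r s a + γ * expectNext T s a (fun s' => ⨆ a', q s' a')

/-- One tabular Q-learning update on the transition `(s, a, s')` with learning rate `η`:
`q(s,a) += η (r(s,a) + γ max_{a'} q(s',a') - q(s,a))`; the other entries do not change. -/
noncomputable def qUpdate {S A : Type*} [DecidableEq S] [DecidableEq A] (γ : ℝ) (r : S → A → ℝ)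
    (η : ℝ) (s : S) (a : A) (s' : S) (q : S → A → ℝ) : S → A → ℝ :=
  fun x b =>
    if x = s ∧ b = a then q x b + η * ((r x b + γ * ⨆ a', q s' a') - q x b) else q x b

/-- The Q-table of the learner of the reward `r`, started at `q₀`, after the first `n` transitions
`(X k ω, U k ω, Y k ω)`, `k < n`, processed with learning rates `α k ω`. -/
noncomputable def qLearn {Ω S A : Type*} [DecidableEq S] [DecidableEq A] (γ : ℝ)
    (X : ℕ → Ω → S) (U : ℕ → Ω → A) (Y : ℕ → Ω → S) (α : ℕ → Ω → ℝ)
    (r : S → A → ℝ) (q₀ : S → A → ℝ) : ℕ → Ω → S → A → ℝ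
  | 0, _ => q₀
  | n + 1, ω =>
      qUpdate γ r (α n ω) (X n ω) (U n ω) (Y n ω) (qLearn γ X U Y α r q₀ n ω)

/-- The AUP penalty of action `a` in state `s`, relative to the auxiliary Q-functions `Q`. -/
noncomputable def penalty {ι S A : Type*} [Fintype ι] (noop : A) (Q : ι → S → A → ℝ)
    (s : S) (a : A) : ℝ :=
  ∑ i, |Q i s a - Q i s noop|

/-- The AUP reward, relative to the auxiliary Q-functions `Q`. The normalization `scale` is chosen
by the designer: it turns the auxiliary Q-functions into a function of the state, as in
`fun Q s => ∑ i, Q i s noop` or, for a mild action `m`, `fun Q s => penalty noop Q s m`. -/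
noncomputable def rAUP {ι S A : Type*} [Fintype ι] (noop : A) (R : S → A → ℝ) (lam : ℝ)
    (scale : (ι → S → A → ℝ) → S → ℝ) (Q : ι → S → A → ℝ) (s : S) (a : A) : ℝ :=
  R s a - lam * (penalty noop Q s a / scale Q s)

/-- Experience gathered in an MDP with transition function `T`. At step `n` the agent is in state
`X n`, takes action `U n` and observes the successor `Y n`. The σ-algebra `ℱ n` is the information
available once `U n` has been selected, and given it `Y n` has law `T (X n) (U n)`. The action rule
may depend on the past in any way. A single trajectory is the case `X (n + 1) = Y n`; leaving
`X (n + 1)` free also allows for episodes with resets. -/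
structure IsExperience {Ω S A : Type*} {mΩ : MeasurableSpace Ω} (μ : Measure Ω)
    (ℱ : Filtration ℕ mΩ) (T : S → A → PMF S)
    (X : ℕ → Ω → S) (U : ℕ → Ω → A) (Y : ℕ → Ω → S) : Prop where
  state_adapted : ∀ n s, MeasurableSet[ℱ n] {ω | X n ω = s}
  action_adapted : ∀ n a, MeasurableSet[ℱ n] {ω | U n ω = a}
  next_adapted : ∀ n s', MeasurableSet[ℱ (n + 1)] {ω | Y n ω = s'}
  transition : ∀ n s',
    μ[{ω | Y n ω = s'}.indicator (fun _ => (1 : ℝ)) | ℱ n]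
      =ᵐ[μ] fun ω => (T (X n ω) (U n ω) s').toReal

/-- Infinite exploration: almost surely every state-action pair is tried infinitely often. -/
def ExploresInfinitely {Ω S A : Type*} {mΩ : MeasurableSpace Ω} (μ : Measure Ω)
    (X : ℕ → Ω → S) (U : ℕ → Ω → A) : Prop :=
  ∀ᵐ ω ∂μ, ∀ s a, ∃ᶠ n in atTop, X n ω = s ∧ U n ω = a

/-- A learning rate schedule: non-negative rates, known before the successor is observed, which
along the visits to each state-action pair almost surely have infinite sum and finite sum of
squares. -/
structure IsLearningRate {Ω S A : Type*} [DecidableEq S] [DecidableEq A] {mΩ : MeasurableSpace Ω}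
    (μ : Measure Ω) (ℱ : Filtration ℕ mΩ) (X : ℕ → Ω → S) (U : ℕ → Ω → A)
    (α : ℕ → Ω → ℝ) : Prop where
  nonneg : ∀ n ω, 0 ≤ α n ω
  adapted : ∀ n, Measurable[ℱ n] (α n)
  sum_infinite : ∀ᵐ ω ∂μ, ∀ s a, Tendsto
    (fun N => ∑ n ∈ Finset.range N, if X n ω = s ∧ U n ω = a then α n ω else 0) atTop atTop
  sum_sq_finite : ∀ᵐ ω ∂μ, ∀ s a,
    Summable (fun n => if X n ω = s ∧ U n ω = a then α n ω ^ 2 else 0)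

end AUP

/-!
A table `q` with `q (n + 1) = (1 - β n) q n + β n f n + e n`, where the rates `β` have infinite sum
and the noise `e` has convergent partial sums, forgets its past and asymptotically obeys every bound
on `f`. For Q-learning `f` is the Bellman operator applied to `q n`, so that an eventual bound `D`
on the distance to the optimal Q-function improves to any bound above `|γ| D`: the limsup of the
distance is zero. The noise of each entry is a finite sum of martingale transforms whose
coefficients, a visit's learning rate times a bounded greedy value, are square summable. After
truncation these transforms are `L²`-bounded martingales, so their partial sums converge.
-/

namespace AUP

/-! ### Averaging recursions -/

section Averaging

theorem abs_one_sub_mul_add_mul_le {t : ℝ} (ht : t ∈ Set.Icc 0 1) (x y : ℝ) :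
    |(1 - t) * x + t * y| ≤ (1 - t) * |x| + t * |y| := by
  refine (abs_add_le _ _).trans_eq ?_
  rw [abs_mul, abs_mul, abs_of_nonneg (sub_nonneg.2 ht.2), abs_of_nonneg ht.1]

theorem abs_averaging_le_add_exp {y g a : ℕ → ℝ} {D : ℝ} {N n : ℕ} (hn : N ≤ n)
    (ha : ∀ k ≥ N, a k ∈ Set.Icc 0 1) (hg : ∀ k ≥ N, |g k| ≤ D)
    (hy : ∀ k ≥ N, y (k + 1) = (1 - a k) * y k + a k * g k) :
    |y n| ≤ D + |y N| * Real.exp (-∑ k ∈ Finset.Ico N n, a k) := by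
  induction n, hn using Nat.le_induction with
  | base => simpa using (abs_nonneg (g N)).trans (hg N le_rfl)
  | succ n hn ih =>
    set σ := ∑ k ∈ Finset.Ico N n, a k
    have h0 : 0 ≤ a n := (ha n hn).1
    have h1 : 0 ≤ 1 - a n := sub_nonneg.2 (ha n hn).2
    calc |y (n + 1)| ≤ (1 - a n) * |y n| + a n * |g n| := by
          rw [hy n hn]; exact abs_one_sub_mul_add_mul_le (ha n hn) _ _
      _ ≤ (1 - a n) * (D + |y N| * Real.exp (-σ)) + a n * D := by gcongr; exact hg n hn
      _ = D + |y N| * ((1 - a n) * Real.exp (-σ)) := by ring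
      _ ≤ D + |y N| * (Real.exp (-a n) * Real.exp (-σ)) := by
          gcongr; exact Real.one_sub_le_exp_neg _
      _ = D + |y N| * Real.exp (-∑ k ∈ Finset.Ico N (n + 1), a k) := by
          rw [← Real.exp_add, Finset.sum_Ico_succ_top hn, neg_add_rev]

variable {a f : ℕ → ℝ} {D ε : ℝ}

theorem eventually_abs_averaging_le {y : ℕ → ℝ} (ha : ∀ᶠ n in atTop, a n ∈ Set.Icc 0 1)
    (hsum : Tendsto (fun N => ∑ n ∈ Finset.range N, a n) atTop atTop)
    (hy : ∀ n, y (n + 1) = (1 - a n) * y n + a n * f n)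
    (hf : ∀ᶠ n in atTop, |f n| ≤ D) (hε : 0 < ε) :
    ∀ᶠ n in atTop, |y n| ≤ D + ε := by
  obtain ⟨N, hN⟩ := eventually_atTop.1 (ha.and hf)
  have hIco : Tendsto (fun n => ∑ k ∈ Finset.Ico N n, a k) atTop atTop :=
    (tendsto_atTop_add_const_right atTop (-∑ k ∈ Finset.range N, a k) hsum).congr' <| by
      filter_upwards [eventually_ge_atTop N] with n hn
      rw [Finset.sum_Ico_eq_sub _ hn, sub_eq_add_neg]
  have hforget : Tendsto (fun n => |y N| * Real.exp (-∑ k ∈ Finset.Ico N n, a k)) atTop (𝓝 0) := by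
    simpa only [mul_zero, Function.comp_def] using
      (Real.tendsto_exp_neg_atTop_nhds_zero.comp hIco).const_mul |y N|
  filter_upwards [eventually_ge_atTop N, hforget.eventually_le_const hε] with n hn hexp
  have := abs_averaging_le_add_exp hn (fun k hk => (hN k hk).1) (fun k hk => (hN k hk).2)
    fun k _ => hy k
  linarith

theorem eventually_abs_noisy_averaging_le {x e : ℕ → ℝ} {E : ℝ}
    (ha : ∀ᶠ n in atTop, a n ∈ Set.Icc 0 1)
    (hsum : Tendsto (fun N => ∑ n ∈ Finset.range N, a n) atTop atTop)
    (he : Tendsto (fun N => ∑ n ∈ Finset.range N, e n) atTop (𝓝 E))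
    (hx : ∀ n, x (n + 1) = (1 - a n) * x n + a n * f n + e n)
    (hf : ∀ᶠ n in atTop, |f n| ≤ D) (hε : 0 < ε) :
    ∀ᶠ n in atTop, |x n| ≤ D + ε := by
  -- Subtracting `δ`, the negative of the remaining noise, from `x` turns the additive noise into a
  -- vanishing perturbation of `f`.
  set δ : ℕ → ℝ := fun n => ∑ k ∈ Finset.range n, e k - E with hδ
  have hδ_small : ∀ᶠ n in atTop, |δ n| ≤ ε / 3 := by
    have hδ_lim : Tendsto (fun n => |δ n|) atTop (𝓝 0) := by simpa using (he.sub_const E).abs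
    exact hδ_lim.eventually_le_const (by positivity)
  have hy : ∀ n, x (n + 1) - δ (n + 1) = (1 - a n) * (x n - δ n) + a n * (f n - δ n) := by
    intro n
    simp only [hδ, hx, Finset.sum_range_succ]
    ring
  have hg : ∀ᶠ n in atTop, |f n - δ n| ≤ D + ε / 3 := by
    filter_upwards [hf, hδ_small] with n hfn hδn
    exact (abs_sub _ _).trans (add_le_add hfn hδn)
  filter_upwards [hδ_small, eventually_abs_averaging_le (y := fun n => x n - δ n) ha hsum hy hg
    (show 0 < ε / 3 by positivity)] with n hδn hyn
  have := abs_sub_abs_le_abs_sub (x n) (δ n)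
  linarith

end Averaging

theorem tendsto_zero_of_eventually_le_mul_add {α : Type*} {l : Filter α} [l.NeBot] {u : α → ℝ}
    {κ : ℝ} (hκ : κ < 1) (hu : ∀ n, 0 ≤ u n) (hbdd : l.IsBoundedUnder (· ≤ ·) u)
    (himprove : ∀ D, (∀ᶠ n in l, u n ≤ D) → ∀ ε > 0, ∀ᶠ n in l, u n ≤ κ * D + ε) :
    Tendsto u l (𝓝 0) := by
  set L := limsup u l
  have hlt : ∀ D, L < D → ∀ᶠ n in l, u n < D := fun D hD => eventually_lt_of_limsup_lt hD hbdd
  have hcobdd : l.IsCoboundedUnder (· ≤ ·) u :=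
    (isBoundedUnder_of ⟨0, hu⟩ : l.IsBoundedUnder (· ≥ ·) u).isCoboundedUnder_le
  have hL_contract : (1 - κ) * L ≤ 0 := by
    refine le_of_forall_pos_le_add fun ε hε => ?_
    have hbound := himprove (L + ε) ((hlt _ (by linarith)).mono fun _ => le_of_lt)
      ((1 - κ) * ε) (mul_pos (sub_pos.2 hκ) hε)
    have := limsup_le_of_le hcobdd hbound
    linarith
  have hL_nonpos : L ≤ 0 := nonpos_of_mul_nonpos_right hL_contract (sub_pos.2 hκ)
  exact tendsto_order.2 ⟨fun b hb => .of_forall fun n => hb.trans_le (hu n),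
    fun b hb => hlt b (hL_nonpos.trans_lt hb)⟩

theorem tendsto_zero_of_contracting_noisy_averaging {κ : Type*} [Fintype κ]
    {z f β e : ℕ → κ → ℝ} {c : ℝ} (hc0 : 0 ≤ c) (hc1 : c < 1)
    (hβ : ∀ᶠ n in atTop, ∀ i, β n i ∈ Set.Icc 0 1)
    (hsum : ∀ i, Tendsto (fun N => ∑ n ∈ Finset.range N, β n i) atTop atTop)
    (he : ∀ i, ∃ E, Tendsto (fun N => ∑ n ∈ Finset.range N, e n i) atTop (𝓝 E))
    (hz : ∀ n i, z (n + 1) i = (1 - β n i) * z n i + β n i * f n i + e n i)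
    (hf : ∀ n i, |f n i| ≤ c * ‖z n‖)
    (hbdd : atTop.IsBoundedUnder (· ≤ ·) fun n => ‖z n‖) :
    Tendsto z atTop (𝓝 0) := by
  refine tendsto_zero_iff_norm_tendsto_zero.2 <|
    tendsto_zero_of_eventually_le_mul_add hc1 (fun n => norm_nonneg _) hbdd fun D hD ε hε => ?_
  have hD0 : 0 ≤ D := let ⟨_, hn⟩ := hD.exists; (norm_nonneg _).trans hn
  have hentry : ∀ᶠ n in atTop, ∀ i, |z n i| ≤ c * D + ε := by
    refine eventually_all.2 fun i => ?_
    obtain ⟨E, hE⟩ := he i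
    refine eventually_abs_noisy_averaging_le (hβ.mono fun n hn => hn i) (hsum i) hE
      (fun n => hz n i) ?_ hε
    filter_upwards [hD] with n hn
    exact (hf n i).trans (mul_le_mul_of_nonneg_left hn hc0)
  filter_upwards [hentry] with n hn
  exact (pi_norm_le_iff_of_nonneg (by positivity)).2 hn

/-! ### The Bellman operator -/

section Bellman

variable {S A : Type*}

/-- The value function of the policy that is greedy with respect to the Q-table `q`. -/
noncomputable def greedyValue (q : S → A → ℝ) (s : S) : ℝ :=
  ⨆ a, q s a

/-- The Bellman optimality operator on Q-tables, whose fixed points are the optimal Q-functions. -/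
noncomputable def bellman [Fintype S] (T : S → A → PMF S) (γ : ℝ) (r q : S → A → ℝ) :
    S → A → ℝ :=
  fun s a => r s a + γ * expectNext T s a (greedyValue q)

theorem isOptimalQ_iff_isFixedPt [Fintype S] {T : S → A → PMF S} {γ : ℝ} {r q : S → A → ℝ} :
    IsOptimalQ T γ r q ↔ Function.IsFixedPt (bellman T γ r) q := by
  simp only [Function.IsFixedPt, funext_iff, eq_comm (b := q _ _)]
  rfl

theorem dist_iSup_le_dist [Fintype A] (f g : A → ℝ) : dist (⨆ a, f a) (⨆ a, g a) ≤ dist f g := by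
  cases isEmpty_or_nonempty A
  · simp
  have hle : ∀ f g : A → ℝ, (⨆ a, f a) ≤ (⨆ a, g a) + dist f g := fun f g => by
    refine ciSup_le fun a => ?_
    have h1 := (le_abs_self _).trans (dist_le_pi_dist f g a)
    have h2 := le_ciSup (Set.finite_range g).bddAbove a
    linarith
  have hfg := hle f g
  have hgf := hle g f
  rw [dist_comm g f] at hgf
  exact abs_le.2 ⟨by linarith, by linarith⟩

variable [Fintype S]

theorem dist_greedyValue_le [Fintype A] (p q : S → A → ℝ) :
    dist (greedyValue p) (greedyValue q) ≤ dist p q :=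
  (dist_pi_le_iff dist_nonneg).2 fun s => (dist_iSup_le_dist _ _).trans (dist_le_pi_dist p q s)

theorem norm_greedyValue_le [Fintype A] (q : S → A → ℝ) : ‖greedyValue q‖ ≤ ‖q‖ := by
  have hzero : greedyValue (0 : S → A → ℝ) = 0 := funext fun _ => Real.iSup_const_zero
  simpa only [hzero, dist_zero_right] using dist_greedyValue_le q 0

theorem sum_toReal_eq_one (p : PMF S) : ∑ s, (p s).toReal = 1 := by
  rw [← ENNReal.toReal_sum fun s _ => p.apply_ne_top s, ← tsum_fintype (L := .unconditional S),
    p.tsum_coe, ENNReal.toReal_one]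

theorem expectNext_sub (T : S → A → PMF S) (s : S) (a : A) (v w : S → ℝ) :
    expectNext T s a (v - w) = expectNext T s a v - expectNext T s a w := by
  simp only [expectNext, Pi.sub_apply, mul_sub, Finset.sum_sub_distrib]

theorem abs_expectNext_le_norm (T : S → A → PMF S) (s : S) (a : A) (v : S → ℝ) :
    |expectNext T s a v| ≤ ‖v‖ :=
  calc |expectNext T s a v| ≤ ∑ s', |(T s a s').toReal * v s'| := Finset.abs_sum_le_sum_abs _ _
    _ ≤ ∑ s', (T s a s').toReal * ‖v‖ := by
      refine Finset.sum_le_sum fun s' _ => ?_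
      rw [abs_mul, abs_of_nonneg ENNReal.toReal_nonneg]
      exact mul_le_mul_of_nonneg_left (norm_le_pi_norm v s') ENNReal.toReal_nonneg
    _ = ‖v‖ := by rw [← Finset.sum_mul, sum_toReal_eq_one, one_mul]

theorem abs_bellman_sub_bellman_le [Fintype A] (T : S → A → PMF S) (γ : ℝ) (r p q : S → A → ℝ)
    (s : S) (a : A) :
    |bellman T γ r p s a - bellman T γ r q s a| ≤ |γ| * dist p q := by
  rw [bellman, bellman, add_sub_add_left_eq_sub, ← mul_sub, ← expectNext_sub, abs_mul]
  gcongr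
  calc |expectNext T s a (greedyValue p - greedyValue q)|
      ≤ ‖greedyValue p - greedyValue q‖ := abs_expectNext_le_norm T s a _
    _ ≤ dist p q := by rw [← dist_eq_norm]; exact dist_greedyValue_le p q

theorem contractingWith_bellman [Fintype A] (T : S → A → PMF S) {γ : ℝ} (hγ : |γ| < 1)
    (r : S → A → ℝ) :
    ContractingWith ‖γ‖₊ (bellman T γ r) := by
  refine ⟨hγ, LipschitzWith.of_dist_le_mul fun p q => ?_⟩
  have hnonneg : 0 ≤ |γ| * dist p q := by positivity
  exact (dist_pi_le_iff hnonneg).2 fun s => (dist_pi_le_iff hnonneg).2 fun a =>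
    abs_bellman_sub_bellman_le T γ r p q s a

theorem exists_isOptimalQ [Finite A] (T : S → A → PMF S) {γ : ℝ} (hγ : |γ| < 1)
    (r : S → A → ℝ) : ∃ q, IsOptimalQ T γ r q :=
  have := Fintype.ofFinite A
  ⟨_, isOptimalQ_iff_isFixedPt.2 (contractingWith_bellman T hγ r).fixedPoint_isFixedPt⟩

end Bellman

/-! ### Q-learning along one trajectory -/

section Trajectory

variable {Ω S A : Type*} [DecidableEq S] [DecidableEq A]

/-- The learning rate applied to the entry `(s, a)` of the Q-table at step `n`; it vanishes unless
`(s, a)` is the state-action pair visited at that step. -/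
def visitRate (X : ℕ → Ω → S) (U : ℕ → Ω → A) (α : ℕ → Ω → ℝ) (s : S) (a : A) (n : ℕ) (ω : Ω) :
    ℝ :=
  if X n ω = s ∧ U n ω = a then α n ω else 0

variable {X : ℕ → Ω → S} {U : ℕ → Ω → A} {Y : ℕ → Ω → S} {α : ℕ → Ω → ℝ} {ω : Ω} {γ : ℝ}
  {r q₀ : S → A → ℝ}

theorem visitRate_mem_Icc {n : ℕ} (hα : α n ω ∈ Set.Icc 0 1) (s : S) (a : A) :
    visitRate X U α s a n ω ∈ Set.Icc 0 1 := by
  unfold visitRate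
  split_ifs
  exacts [hα, ⟨le_rfl, zero_le_one⟩]

theorem eventually_le_one_of_summable_sq_visitRate [Finite S] [Finite A]
    (hsq : ∀ s a, Summable fun n => visitRate X U α s a n ω ^ 2) :
    ∀ᶠ n in atTop, α n ω ≤ 1 := by
  have hvisit : ∀ᶠ n in atTop, ∀ s a, visitRate X U α s a n ω ^ 2 ≤ 1 :=
    eventually_all.2 fun s => eventually_all.2 fun a =>
      (hsq s a).tendsto_atTop_zero.eventually_le_const one_pos
  filter_upwards [hvisit] with n hn
  have hα : α n ω ^ 2 ≤ 1 := by simpa only [visitRate, and_self, if_true] using hn (X n ω) (U n ω)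
  exact (le_abs_self _).trans ((sq_le_one_iff_abs_le_one _).1 hα)

theorem qLearn_succ_apply [Fintype S] (T : S → A → PMF S) (n : ℕ) (s : S) (a : A) :
    qLearn γ X U Y α r q₀ (n + 1) ω s a =
      (1 - visitRate X U α s a n ω) * qLearn γ X U Y α r q₀ n ω s a +
        visitRate X U α s a n ω * bellman T γ r (qLearn γ X U Y α r q₀ n ω) s a +
        γ * (visitRate X U α s a n ω * (greedyValue (qLearn γ X U Y α r q₀ n ω) (Y n ω) -
          expectNext T (X n ω) (U n ω) (greedyValue (qLearn γ X U Y α r q₀ n ω)))) := by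
  simp only [qLearn, qUpdate, visitRate, bellman, eq_comm (a := s), eq_comm (a := a)]
  split_ifs with h
  · rw [← h.1, ← h.2, greedyValue]
    ring
  · ring

variable [Fintype S]

theorem norm_qUpdate_le [Fintype A] {η B : ℝ} {q : S → A → ℝ} (hη : η ∈ Set.Icc 0 1)
    (hq : ‖q‖ ≤ B) (hB : ‖r‖ + |γ| * B ≤ B) (s : S) (a : A) (s' : S) :
    ‖qUpdate γ r η s a s' q‖ ≤ B := by
  have hB0 : 0 ≤ B := (norm_nonneg q).trans hq
  refine (pi_norm_le_iff_of_nonneg hB0).2 fun x => (pi_norm_le_iff_of_nonneg hB0).2 fun b => ?_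
  have hentry : ∀ p : S → A → ℝ, |p x b| ≤ ‖p‖ := fun p =>
    (norm_le_pi_norm (p x) b).trans (norm_le_pi_norm p x)
  have htarget : |r x b + γ * greedyValue q s'| ≤ B :=
    calc |r x b + γ * greedyValue q s'| ≤ |r x b| + |γ| * |greedyValue q s'| := by
          rw [← abs_mul]; exact abs_add_le _ _
      _ ≤ ‖r‖ + |γ| * B := by
          gcongr
          · exact hentry r
          · exact (norm_le_pi_norm (greedyValue q) s').trans ((norm_greedyValue_le q).trans hq)
      _ ≤ B := hB
  rw [qUpdate, Real.norm_eq_abs]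
  split_ifs
  · calc |q x b + η * ((r x b + γ * greedyValue q s') - q x b)|
        = |(1 - η) * q x b + η * (r x b + γ * greedyValue q s')| := by ring_nf
      _ ≤ (1 - η) * |q x b| + η * |r x b + γ * greedyValue q s'| :=
          abs_one_sub_mul_add_mul_le hη _ _
      _ ≤ (1 - η) * B + η * B :=
          add_le_add (mul_le_mul_of_nonneg_left ((hentry q).trans hq) (sub_nonneg.2 hη.2))
            (mul_le_mul_of_nonneg_left htarget hη.1)
      _ = B := by ring
  · exact (hentry q).trans hq

theorem isBoundedUnder_norm_qLearn [Fintype A] (hγ : |γ| < 1)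
    (hα : ∀ᶠ n in atTop, α n ω ∈ Set.Icc 0 1) :
    atTop.IsBoundedUnder (· ≤ ·) fun n => ‖qLearn γ X U Y α r q₀ n ω‖ := by
  obtain ⟨N, hN⟩ := eventually_atTop.1 hα
  set B := max ‖qLearn γ X U Y α r q₀ N ω‖ (‖r‖ / (1 - |γ|))
  have hB : ‖r‖ + |γ| * B ≤ B := by
    have := (div_le_iff₀ (sub_pos.2 hγ)).1 (le_max_right _ _ : ‖r‖ / (1 - |γ|) ≤ B)
    linarith
  refine isBoundedUnder_of_eventually_le (a := B) (eventually_atTop.2 ⟨N, fun n hn => ?_⟩)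
  induction n, hn using Nat.le_induction with
  | base => exact le_max_left _ _
  | succ n hn ih => exact norm_qUpdate_le (hN n hn) ih hB _ _ _

theorem tendsto_qLearn [Finite A] {T : S → A → PMF S} {qstar : S → A → ℝ} (hγ : |γ| < 1)
    (hstar : IsOptimalQ T γ r qstar) (hα : ∀ᶠ n in atTop, α n ω ∈ Set.Icc 0 1)
    (hsum : ∀ s a, Tendsto
      (fun N => ∑ n ∈ Finset.range N, visitRate X U α s a n ω) atTop atTop)
    (hnoise : ∀ s a, ∃ E, Tendsto (fun N => ∑ n ∈ Finset.range N, visitRate X U α s a n ω *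
      (greedyValue (qLearn γ X U Y α r q₀ n ω) (Y n ω) -
        expectNext T (X n ω) (U n ω) (greedyValue (qLearn γ X U Y α r q₀ n ω)))) atTop (𝓝 E)) :
    Tendsto (fun n => qLearn γ X U Y α r q₀ n ω) atTop (𝓝 qstar) := by
  cases nonempty_fintype A
  set q := fun n => qLearn γ X U Y α r q₀ n ω
  set z : ℕ → S × A → ℝ := fun n i => q n i.1 i.2 - qstar i.1 i.2
  have hnorm : ∀ n, ‖z n‖ = dist (q n) qstar := fun n => by
    refine le_antisymm ((pi_norm_le_iff_of_nonneg dist_nonneg).2 fun i => ?_)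
      ((dist_pi_le_iff (norm_nonneg _)).2 fun s => (dist_pi_le_iff (norm_nonneg _)).2 fun a =>
        norm_le_pi_norm (z n) (s, a))
    exact (dist_le_pi_dist (q n i.1) (qstar i.1) i.2).trans (dist_le_pi_dist (q n) qstar i.1)
  have hz : Tendsto z atTop (𝓝 0) := by
    refine tendsto_zero_of_contracting_noisy_averaging (abs_nonneg γ) hγ
      (f := fun n i => bellman T γ r (q n) i.1 i.2 - bellman T γ r qstar i.1 i.2)
      (e := fun n i => γ * (visitRate X U α i.1 i.2 n ω *
        (greedyValue (q n) (Y n ω) - expectNext T (X n ω) (U n ω) (greedyValue (q n)))))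
      (hα.mono fun n hn i => visitRate_mem_Icc hn i.1 i.2) (fun i => hsum i.1 i.2)
      (fun i => ?_) (fun n i => ?_) (fun n i => ?_) ?_
    · obtain ⟨E, hE⟩ := hnoise i.1 i.2
      exact ⟨γ * E, by simpa only [Finset.mul_sum] using hE.const_mul γ⟩
    · simp only [z, q]
      rw [qLearn_succ_apply T, isOptimalQ_iff_isFixedPt.1 hstar]
      ring
    · rw [hnorm]
      exact abs_bellman_sub_bellman_le T γ r (q n) qstar i.1 i.2
    · obtain ⟨B, hB⟩ := (isBoundedUnder_norm_qLearn (X := X) (U := U) (Y := Y) (r := r) (q₀ := q₀)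
        hγ hα).eventually_le
      refine isBoundedUnder_of_eventually_le (a := B + ‖qstar‖) (hB.mono fun n hn => ?_)
      rw [hnorm, dist_eq_norm]
      exact (norm_sub_le _ _).trans (by gcongr)
  rw [tendsto_iff_dist_tendsto_zero]
  simpa only [hnorm, norm_zero] using hz.norm

end Trajectory

/-! ### Martingale transforms -/

section Martingale

variable {Ω : Type*} {mΩ : MeasurableSpace Ω} {μ : Measure Ω} {ℱ : Filtration ℕ mΩ}

/-- A sequence of martingale differences of `ℱ` bounded by `C`. The difference `ξ n` is revealed at
time `n + 1`. -/
structure IsBoundedMartingaleDifference (μ : Measure Ω) (ℱ : Filtration ℕ mΩ) (ξ : ℕ → Ω → ℝ)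
    (C : ℝ) : Prop where
  measurable : ∀ n, Measurable[ℱ (n + 1)] (ξ n)
  bound : ∀ n ω, |ξ n ω| ≤ C
  condExp_eq_zero : ∀ n, μ[ξ n | ℱ n] =ᵐ[μ] 0

/-- The martingale transform of the differences `ξ` with coefficients `c`, a discrete stochastic
integral. -/
def martingaleTransform (c ξ : ℕ → Ω → ℝ) (n : ℕ) (ω : Ω) : ℝ :=
  ∑ k ∈ Finset.range n, c k ω * ξ k ω

theorem martingaleTransform_succ (c ξ : ℕ → Ω → ℝ) (n : ℕ) (ω : Ω) :
    martingaleTransform c ξ (n + 1) ω = martingaleTransform c ξ n ω + c n ω * ξ n ω :=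
  Finset.sum_range_succ _ _

namespace IsBoundedMartingaleDifference

variable {c ξ : ℕ → Ω → ℝ} {C : ℝ}

theorem memLp_mul {p : ENNReal} (hξ : IsBoundedMartingaleDifference μ ℱ ξ C) {n : ℕ} {f : Ω → ℝ}
    (hf : MemLp f p μ) : MemLp (fun ω => f ω * ξ n ω) p μ := by
  have hξm : AEStronglyMeasurable (ξ n) μ :=
    ((hξ.measurable n).mono (ℱ.le _) le_rfl).aestronglyMeasurable
  refine hf.of_le_mul (c := C) (hf.1.mul hξm) (ae_of_all _ fun ω => ?_)
  rw [norm_mul, mul_comm]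
  exact mul_le_mul_of_nonneg_right (hξ.bound n ω) (norm_nonneg _)

theorem memLp_martingaleTransform {p : ENNReal} (hξ : IsBoundedMartingaleDifference μ ℱ ξ C)
    (hc : ∀ n, MemLp (c n) p μ) (n : ℕ) : MemLp (martingaleTransform c ξ n) p μ :=
  memLp_finsetSum _ fun k _ => hξ.memLp_mul (hc k)

end IsBoundedMartingaleDifference

/-- The coefficients `c`, set to zero from the first time on at which their sum of squares exceeds
`K`. The sum includes the current time, so that truncation preserves adaptedness and the truncated
sum of squares never exceeds `K`. -/
noncomputable def truncateSumSq (K : ℝ) (c : ℕ → Ω → ℝ) (n : ℕ) (ω : Ω) : ℝ :=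
  if ∑ k ∈ Finset.range (n + 1), c k ω ^ 2 ≤ K then c n ω else 0

theorem measurable_truncateSumSq {c : ℕ → Ω → ℝ} (hc : ∀ n, Measurable[ℱ n] (c n)) (K : ℝ)
    (n : ℕ) : Measurable[ℱ n] (truncateSumSq K c n) := by
  have hsum : Measurable[ℱ n] fun ω => ∑ k ∈ Finset.range (n + 1), c k ω ^ 2 :=
    Finset.measurable_fun_sum _ fun k hk =>
      ((hc k).mono (ℱ.mono (Finset.mem_range_succ_iff.1 hk)) le_rfl).pow_const 2
  exact Measurable.ite (hsum measurableSet_Iic) (hc n) measurable_const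

theorem sum_sq_truncateSumSq_le {K : ℝ} (hK : 0 ≤ K) (c : ℕ → Ω → ℝ) (n : ℕ) (ω : Ω) :
    ∑ k ∈ Finset.range n, truncateSumSq K c k ω ^ 2 ≤ K := by
  have hle : ∀ n, truncateSumSq K c n ω ^ 2 ≤ c n ω ^ 2 := fun n => by
    rw [truncateSumSq]
    split_ifs
    exacts [le_rfl, (zero_pow two_ne_zero).trans_le (sq_nonneg _)]
  induction n with
  | zero => simpa using hK
  | succ n ih =>
    by_cases h : ∑ k ∈ Finset.range (n + 1), c k ω ^ 2 ≤ K
    · exact (Finset.sum_le_sum fun k _ => hle k).trans h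
    · rwa [Finset.sum_range_succ, truncateSumSq, if_neg h, zero_pow two_ne_zero, add_zero]

theorem truncateSumSq_eq_self {c : ℕ → Ω → ℝ} {K : ℝ} {ω : Ω}
    (hs : Summable fun n => c n ω ^ 2) (hK : ∑' n, c n ω ^ 2 ≤ K) (n : ℕ) :
    truncateSumSq K c n ω = c n ω :=
  if_pos <| (hs.sum_le_tsum _ fun _ _ => sq_nonneg _).trans hK

variable [IsFiniteMeasure μ]

theorem integral_mul_sub_eq_zero_of_martingale {M : ℕ → Ω → ℝ} (hM : Martingale M ℱ μ)
    (hL2 : ∀ n, MemLp (M n) 2 μ) (n : ℕ) : ∫ ω, M n ω * (M (n + 1) ω - M n ω) ∂μ = 0 := by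
  have hcond : μ[M (n + 1) - M n | ℱ n] =ᵐ[μ] 0 := by
    filter_upwards [condExp_sub (hM.integrable (n + 1)) (hM.integrable n) (ℱ n),
      hM.condExp_ae_eq n.le_succ, hM.condExp_ae_eq (le_refl n)] with ω hsub hsucc hself
    rw [hsub, Pi.sub_apply, hsucc, hself, sub_self, Pi.zero_apply]
  have hpull : μ[M n * (M (n + 1) - M n) | ℱ n] =ᵐ[μ] 0 := by
    filter_upwards [hcond, condExp_mul_of_stronglyMeasurable_left (hM.stronglyMeasurable n)
      ((hL2 n).integrable_mul ((hL2 (n + 1)).sub (hL2 n)))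
      ((hM.integrable (n + 1)).sub (hM.integrable n))] with ω hω hmul
    rw [hmul, Pi.mul_apply, hω, Pi.zero_apply, mul_zero]
  calc ∫ ω, M n ω * (M (n + 1) ω - M n ω) ∂μ
      = ∫ ω, (μ[M n * (M (n + 1) - M n) | ℱ n]) ω ∂μ := (integral_condExp (ℱ.le n)).symm
    _ = 0 := by rw [integral_congr_ae hpull]; exact integral_zero _ _

theorem integral_sq_succ_of_martingale {M : ℕ → Ω → ℝ} (hM : Martingale M ℱ μ)
    (hL2 : ∀ n, MemLp (M n) 2 μ) (n : ℕ) :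
    ∫ ω, M (n + 1) ω ^ 2 ∂μ = ∫ ω, M n ω ^ 2 ∂μ + ∫ ω, (M (n + 1) ω - M n ω) ^ 2 ∂μ := by
  have hsub : MemLp (fun ω => M (n + 1) ω - M n ω) 2 μ := (hL2 (n + 1)).sub (hL2 n)
  have hcross : Integrable (fun ω => M n ω * (M (n + 1) ω - M n ω)) μ :=
    (hL2 n).integrable_mul hsub
  have hexpand : ∀ ω, M (n + 1) ω ^ 2 =
      M n ω ^ 2 + 2 * (M n ω * (M (n + 1) ω - M n ω)) + (M (n + 1) ω - M n ω) ^ 2 :=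
    fun ω => by ring
  simp_rw [hexpand]
  rw [integral_add (by exact (hL2 n).integrable_sq.add (hcross.const_mul 2)) hsub.integrable_sq,
    integral_add (hL2 n).integrable_sq (hcross.const_mul 2), integral_const_mul,
    integral_mul_sub_eq_zero_of_martingale hM hL2, mul_zero, add_zero]

theorem ae_exists_tendsto_of_integral_sq_le {M : ℕ → Ω → ℝ} (hM : Martingale M ℱ μ)
    (hL2 : ∀ n, MemLp (M n) 2 μ) {K : ℝ} (hK : ∀ n, ∫ ω, M n ω ^ 2 ∂μ ≤ K) :
    ∀ᵐ ω ∂μ, ∃ E, Tendsto (fun n => M n ω) atTop (𝓝 E) := by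
  refine hM.submartingale.exists_ae_tendsto_of_bdd (R := Real.toNNReal (μ.real Set.univ + K))
    fun n => ?_
  rw [eLpNorm_one_eq_lintegral_enorm, ← ofReal_integral_norm_eq_lintegral_enorm (hM.integrable n)]
  refine ENNReal.ofReal_le_ofReal ?_
  calc ∫ ω, ‖M n ω‖ ∂μ ≤ ∫ ω, (1 + M n ω ^ 2) ∂μ := by
        refine integral_mono (hM.integrable n).norm
          ((integrable_const 1).add (hL2 n).integrable_sq) fun ω => ?_
        have := sq_abs (M n ω)
        simp only [Real.norm_eq_abs]
        nlinarith [sq_nonneg (|M n ω| - 1)]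
    _ = μ.real Set.univ + ∫ ω, M n ω ^ 2 ∂μ := by
        rw [integral_add (integrable_const 1) (hL2 n).integrable_sq, integral_const, smul_eq_mul,
          mul_one]
    _ ≤ μ.real Set.univ + K := by gcongr; exact hK n

namespace IsBoundedMartingaleDifference

variable {c ξ : ℕ → Ω → ℝ} {C : ℝ}

theorem martingale_martingaleTransform (hξ : IsBoundedMartingaleDifference μ ℱ ξ C)
    (hcm : ∀ n, Measurable[ℱ n] (c n)) (hc : ∀ n, Integrable (c n) μ) :
    Martingale (martingaleTransform c ξ) ℱ μ := by
  have hc1 : ∀ n, MemLp (c n) 1 μ := fun n => memLp_one_iff_integrable.2 (hc n)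
  have hadapted : ∀ n, Measurable[ℱ n] (martingaleTransform c ξ n) := fun n =>
    Finset.measurable_fun_sum _ fun k hk =>
      ((hcm k).mono (ℱ.mono (Finset.mem_range.1 hk).le) le_rfl).mul
        ((hξ.measurable k).mono (ℱ.mono (Finset.mem_range.1 hk)) le_rfl)
  refine martingale_of_condExp_sub_eq_zero_nat (fun n => (hadapted n).stronglyMeasurable)
    (fun n => (hξ.memLp_martingaleTransform hc1 n).integrable le_rfl) fun n => ?_
  have hincrement : martingaleTransform c ξ (n + 1) - martingaleTransform c ξ n = c n * ξ n := by
    ext ω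
    simp only [Pi.sub_apply, Pi.mul_apply, martingaleTransform_succ, add_sub_cancel_left]
  have hξint : Integrable (ξ n) μ :=
    Integrable.of_bound ((hξ.measurable n).mono (ℱ.le _) le_rfl).aestronglyMeasurable C
      (ae_of_all _ (hξ.bound n))
  rw [hincrement]
  filter_upwards [hξ.condExp_eq_zero n, condExp_mul_of_stronglyMeasurable_left
    (hcm n).stronglyMeasurable ((hξ.memLp_mul (hc1 n)).integrable le_rfl) hξint] with ω hω hmul
  rw [hmul, Pi.mul_apply, hω, Pi.zero_apply, mul_zero]

theorem integral_sq_martingaleTransform_le (hξ : IsBoundedMartingaleDifference μ ℱ ξ C)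
    (hcm : ∀ n, Measurable[ℱ n] (c n)) (hc : ∀ n, MemLp (c n) 2 μ) (n : ℕ) :
    ∫ ω, martingaleTransform c ξ n ω ^ 2 ∂μ ≤
      C ^ 2 * ∑ k ∈ Finset.range n, ∫ ω, c k ω ^ 2 ∂μ := by
  have hmart := hξ.martingale_martingaleTransform hcm fun n => (hc n).integrable one_le_two
  induction n with
  | zero => simp [martingaleTransform]
  | succ n ih =>
    have hincrement : ∫ ω, (c n ω * ξ n ω) ^ 2 ∂μ ≤ C ^ 2 * ∫ ω, c n ω ^ 2 ∂μ := by
      rw [← integral_const_mul]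
      refine integral_mono (hξ.memLp_mul (hc n)).integrable_sq
        ((hc n).integrable_sq.const_mul _) fun ω => ?_
      have hsq : ξ n ω ^ 2 ≤ C ^ 2 := sq_le_sq' (abs_le.1 (hξ.bound n ω)).1
        (abs_le.1 (hξ.bound n ω)).2
      simp only [mul_pow, mul_comm (C ^ 2)]
      gcongr
    rw [integral_sq_succ_of_martingale hmart (hξ.memLp_martingaleTransform hc),
      Finset.sum_range_succ, mul_add]
    simp only [martingaleTransform_succ, add_sub_cancel_left]
    exact add_le_add ih hincrement

theorem ae_exists_tendsto_of_sum_sq_le (hξ : IsBoundedMartingaleDifference μ ℱ ξ C)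
    (hcm : ∀ n, Measurable[ℱ n] (c n)) {K : ℝ}
    (hK : ∀ n ω, ∑ k ∈ Finset.range n, c k ω ^ 2 ≤ K) :
    ∀ᵐ ω ∂μ, ∃ E, Tendsto (fun n => martingaleTransform c ξ n ω) atTop (𝓝 E) := by
  have hbound : ∀ n ω, |c n ω| ≤ √K := fun n ω => Real.abs_le_sqrt <|
    (Finset.single_le_sum (f := fun k => c k ω ^ 2) (fun _ _ => sq_nonneg _)
      (Finset.self_mem_range_succ n)).trans (hK (n + 1) ω)
  have hc : ∀ n, MemLp (c n) 2 μ := fun n =>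
    MemLp.of_bound ((hcm n).mono (ℱ.le n) le_rfl).aestronglyMeasurable _ (ae_of_all _ (hbound n))
  refine ae_exists_tendsto_of_integral_sq_le
    (hξ.martingale_martingaleTransform hcm fun n => (hc n).integrable one_le_two)
    (hξ.memLp_martingaleTransform hc) (K := C ^ 2 * ∫ _, K ∂μ) fun n => ?_
  refine (hξ.integral_sq_martingaleTransform_le hcm hc n).trans ?_
  rw [← integral_finsetSum _ fun k _ => (hc k).integrable_sq]
  refine mul_le_mul_of_nonneg_left ?_ (sq_nonneg C)
  exact integral_mono (integrable_finsetSum _ fun k _ => (hc k).integrable_sq)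
    (integrable_const K) (hK n)

theorem ae_exists_tendsto_of_summable_sq (hξ : IsBoundedMartingaleDifference μ ℱ ξ C)
    (hcm : ∀ n, Measurable[ℱ n] (c n)) :
    ∀ᵐ ω ∂μ, Summable (fun n => c n ω ^ 2) →
      ∃ E, Tendsto (fun n => martingaleTransform c ξ n ω) atTop (𝓝 E) := by
  have htrunc : ∀ᵐ ω ∂μ, ∀ K : ℕ, ∃ E,
      Tendsto (fun n => martingaleTransform (truncateSumSq K c) ξ n ω) atTop (𝓝 E) :=
    ae_all_iff.2 fun K => hξ.ae_exists_tendsto_of_sum_sq_le (measurable_truncateSumSq hcm K)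
      (sum_sq_truncateSumSq_le K.cast_nonneg c)
  filter_upwards [htrunc] with ω hω hs
  obtain ⟨K, hK⟩ := exists_nat_ge (∑' n, c n ω ^ 2)
  simpa only [martingaleTransform, truncateSumSq_eq_self hs hK] using hω K

end IsBoundedMartingaleDifference

end Martingale

/-! ### Almost sure convergence of Q-learning -/

section AlmostSure

theorem measurable_apply_of_countable {Ω S β : Type*} {mΩ : MeasurableSpace Ω}
    [MeasurableSpace β] [Countable S] {Z : Ω → S} (hZ : ∀ s, MeasurableSet {ω | Z ω = s})
    {f : S → Ω → β} (hf : ∀ s, Measurable (f s)) : Measurable fun ω => f (Z ω) ω := by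
  let _ : MeasurableSpace S := ⊤
  exact (measurable_from_prod_countable_right (f := fun p : S × Ω => f p.1 p.2) hf).comp
    ((measurable_to_countable' hZ).prodMk measurable_id)

variable {Ω S A : Type*} {mΩ : MeasurableSpace Ω} {μ : Measure Ω} {ℱ : Filtration ℕ mΩ}
  {T : S → A → PMF S} {X : ℕ → Ω → S} {U : ℕ → Ω → A} {Y : ℕ → Ω → S} {α : ℕ → Ω → ℝ} {γ : ℝ}
  {r q₀ : S → A → ℝ}

namespace IsExperience

theorem measurable_visitRate [DecidableEq S] [DecidableEq A] (hexp : IsExperience μ ℱ T X U Y)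
    {n : ℕ} (hα : Measurable[ℱ n] (α n)) (s : S) (a : A) :
    Measurable[ℱ n] (visitRate X U α s a n) :=
  Measurable.ite ((hexp.state_adapted n s).inter (hexp.action_adapted n a)) hα measurable_const

theorem measurable_qLearn [Countable S] [Countable A] [DecidableEq S] [DecidableEq A]
    (hexp : IsExperience μ ℱ T X U Y) (hα : ∀ n, Measurable[ℱ n] (α n)) (n : ℕ) (s : S) (a : A) :
    Measurable[ℱ n] fun ω => qLearn γ X U Y α r q₀ n ω s a := by
  induction n generalizing s a with
  | zero => exact measurable_const
  | succ n ih =>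
    have hmono : ∀ {f : Ω → ℝ}, Measurable[ℱ n] f → Measurable[ℱ (n + 1)] f := fun hf =>
      hf.mono (ℱ.mono n.le_succ) le_rfl
    have hgreedy : Measurable[ℱ (n + 1)] fun ω =>
        greedyValue (qLearn γ X U Y α r q₀ n ω) (Y n ω) :=
      measurable_apply_of_countable (f := fun s' ω => greedyValue (qLearn γ X U Y α r q₀ n ω) s')
        (hexp.next_adapted n) fun s' => hmono (Measurable.iSup fun a' => ih s' a')
    have hvisit : MeasurableSet[ℱ (n + 1)] {ω | s = X n ω ∧ a = U n ω} := by
      simp only [eq_comm (a := s), eq_comm (a := a)]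
      exact ℱ.mono n.le_succ _ ((hexp.state_adapted n s).inter (hexp.action_adapted n a))
    have hold := hmono (ih s a)
    exact Measurable.ite hvisit (hold.add ((hmono (hα n)).mul
      (((hgreedy.const_mul γ).const_add (r s a)).sub hold))) hold

theorem measurable_transition [Countable S] [Countable A] (hexp : IsExperience μ ℱ T X U Y)
    (n : ℕ) (s' : S) : Measurable[ℱ n] fun ω => (T (X n ω) (U n ω) s').toReal :=
  measurable_apply_of_countable (f := fun s ω => (T s (U n ω) s').toReal)
    (hexp.state_adapted n) fun s =>
      measurable_apply_of_countable (f := fun a _ => (T s a s').toReal)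
        (hexp.action_adapted n) fun _ => measurable_const

variable [IsFiniteMeasure μ]

theorem isBoundedMartingaleDifference [Countable S] [Countable A]
    (hexp : IsExperience μ ℱ T X U Y) (s' : S) :
    IsBoundedMartingaleDifference μ ℱ
      (fun n ω => {ω | Y n ω = s'}.indicator (fun _ => 1) ω - (T (X n ω) (U n ω) s').toReal)
      1 where
  measurable n := (measurable_const.indicator (hexp.next_adapted n s')).sub
    ((hexp.measurable_transition n s').mono (ℱ.mono n.le_succ) le_rfl)
  bound n ω := by
    have hT : (T (X n ω) (U n ω) s').toReal ∈ Set.Icc 0 1 :=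
      ⟨ENNReal.toReal_nonneg, ENNReal.toReal_le_of_le_ofReal zero_le_one (by
        simpa only [ENNReal.ofReal_one] using (T (X n ω) (U n ω)).coe_le_one s')⟩
    have hind : {ω | Y n ω = s'}.indicator (fun _ => (1 : ℝ)) ω ∈ Set.Icc 0 1 :=
      ⟨Set.indicator_nonneg (fun _ _ => zero_le_one) ω,
        Set.indicator_le_self' (fun _ _ => zero_le_one) ω⟩
    exact abs_sub_le_of_nonneg_of_le hind.1 hind.2 hT.1 hT.2
  condExp_eq_zero n := by
    have hTm := hexp.measurable_transition n s'
    have hTint : Integrable (fun ω => (T (X n ω) (U n ω) s').toReal) μ :=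
      integrable_condExp.congr (hexp.transition n s')
    have hindint : Integrable ({ω | Y n ω = s'}.indicator fun _ => (1 : ℝ)) μ :=
      (integrable_const 1).indicator (ℱ.le _ _ (hexp.next_adapted n s'))
    filter_upwards [condExp_sub hindint hTint (ℱ n), hexp.transition n s'] with ω hsub htrans
    refine hsub.trans ?_
    rw [Pi.sub_apply, htrans, condExp_of_stronglyMeasurable (ℱ.le n) hTm.stronglyMeasurable hTint,
      sub_self, Pi.zero_apply]

theorem ae_exists_tendsto_samplingNoise [Fintype S] [Countable A]
    (hexp : IsExperience μ ℱ T X U Y) {β : ℕ → Ω → ℝ} {v : ℕ → Ω → S → ℝ}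
    (hβ : ∀ n, Measurable[ℱ n] (β n)) (hv : ∀ n s', Measurable[ℱ n] fun ω => v n ω s') :
    ∀ᵐ ω ∂μ, (∀ s', Summable fun n => (β n ω * v n ω s') ^ 2) →
      ∃ E, Tendsto (fun N => ∑ n ∈ Finset.range N,
        β n ω * (v n ω (Y n ω) - expectNext T (X n ω) (U n ω) (v n ω))) atTop (𝓝 E) := by
  classical
  have hstate : ∀ᵐ ω ∂μ, ∀ s', Summable (fun n => (β n ω * v n ω s') ^ 2) →
      ∃ E, Tendsto (fun N => martingaleTransform (fun n ω => β n ω * v n ω s')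
        (fun n ω => {ω | Y n ω = s'}.indicator (fun _ => 1) ω - (T (X n ω) (U n ω) s').toReal)
        N ω) atTop (𝓝 E) :=
    ae_all_iff.2 fun s' => (hexp.isBoundedMartingaleDifference s').ae_exists_tendsto_of_summable_sq
      fun n => (hβ n).mul (hv n s')
  filter_upwards [hstate] with ω hω hsq
  choose E hE using fun s' => hω s' (hsq s')
  refine ⟨∑ s', E s', (tendsto_finsetSum _ fun s' _ => hE s').congr fun N => ?_⟩
  simp only [martingaleTransform]
  rw [Finset.sum_comm]
  refine Finset.sum_congr rfl fun n _ => ?_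
  have hY : v n ω (Y n ω) = ∑ s', {ω | Y n ω = s'}.indicator (fun _ => 1) ω * v n ω s' := by
    simp [Set.indicator_apply]
  rw [hY, expectNext, ← Finset.sum_sub_distrib, Finset.mul_sum]
  exact Finset.sum_congr rfl fun s' _ => by ring

end IsExperience

theorem summable_sq_mul_of_isBoundedUnder_norm {E : Type*} [SeminormedAddCommGroup E]
    {β v : ℕ → ℝ} {q : ℕ → E} (hβ : Summable fun n => β n ^ 2)
    (hq : atTop.IsBoundedUnder (· ≤ ·) fun n => ‖q n‖) (hv : ∀ n, |v n| ≤ ‖q n‖) :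
    Summable fun n => (β n * v n) ^ 2 := by
  obtain ⟨B, hB⟩ := hq.eventually_le
  refine (hβ.mul_right (B ^ 2)).of_norm_bounded_eventually_nat ?_
  filter_upwards [hB] with n hn
  rw [Real.norm_of_nonneg (sq_nonneg _), mul_pow]
  exact mul_le_mul_of_nonneg_left (sq_le_sq.2 (((hv n).trans hn).trans (le_abs_self B)))
    (sq_nonneg _)

theorem ae_tendsto_qLearn [Fintype S] [Finite A] [DecidableEq S] [DecidableEq A]
    [IsFiniteMeasure μ] {qstar : S → A → ℝ} (hγ : |γ| < 1) (hexp : IsExperience μ ℱ T X U Y)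
    (hα : IsLearningRate μ ℱ X U α) (hstar : IsOptimalQ T γ r qstar) :
    ∀ᵐ ω ∂μ, Tendsto (fun n => qLearn γ X U Y α r q₀ n ω) atTop (𝓝 qstar) := by
  cases nonempty_fintype A
  have hgreedy : ∀ n s', Measurable[ℱ n] fun ω => greedyValue (qLearn γ X U Y α r q₀ n ω) s' :=
    fun n s' => Measurable.iSup fun a' => hexp.measurable_qLearn hα.adapted n s' a'
  have hnoise := ae_all_iff.2 fun s => ae_all_iff.2 fun a =>
    hexp.ae_exists_tendsto_samplingNoise
      (fun n => hexp.measurable_visitRate (hα.adapted n) s a) hgreedy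
  filter_upwards [hα.sum_infinite, hα.sum_sq_finite, hnoise] with ω hsum hsum_sq hnoise
  have hsq : ∀ s a, Summable fun n => visitRate X U α s a n ω ^ 2 := fun s a => by
    simpa only [visitRate, ite_pow, zero_pow two_ne_zero] using hsum_sq s a
  have hα_mem : ∀ᶠ n in atTop, α n ω ∈ Set.Icc 0 1 :=
    (eventually_le_one_of_summable_sq_visitRate hsq).mono fun n hn => ⟨hα.nonneg n ω, hn⟩
  exact tendsto_qLearn hγ hstar hα_mem hsum fun s a => hnoise s a fun s' =>
    summable_sq_mul_of_isBoundedUnder_norm (hsq s a) (isBoundedUnder_norm_qLearn hγ hα_mem)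
      fun n => (norm_le_pi_norm _ s').trans (norm_greedyValue_le _)

end AlmostSure

theorem tendsto_rAUP {κ ι S A : Type*} [Fintype ι] {l : Filter κ} {noop : A} {R : S → A → ℝ}
    {lam : ℝ} {scale : (ι → S → A → ℝ) → S → ℝ} {Q : κ → ι → S → A → ℝ} {Qlim : ι → S → A → ℝ}
    {s : S} {σ : ℝ} (hQ : Tendsto Q l (𝓝 Qlim))
    (hscale : Tendsto (fun n => scale (Q n) s) l (𝓝 σ)) (hσ : σ ≠ 0) (a : A) :
    Tendsto (fun n => rAUP noop R lam scale (Q n) s a) l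
      (𝓝 (R s a - lam * (penalty noop Qlim s a / σ))) := by
  have hentry : ∀ i b, Tendsto (fun n => Q n i s b) l (𝓝 (Qlim i s b)) := fun i b =>
    ((hQ.apply_nhds i).apply_nhds s).apply_nhds b
  have hpenalty : Tendsto (fun n => penalty noop (Q n) s a) l (𝓝 (penalty noop Qlim s a)) :=
    tendsto_finsetSum _ fun i _ => ((hentry i a).sub (hentry i noop)).abs
  exact ((hpenalty.div hscale hσ).const_mul lam).const_sub (R s a)

end AUP

theorem mainTheorem2_general
    {S A ι : Type*} [Fintype S] [DecidableEq S] [Finite A] [DecidableEq A] [Fintype ι]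
    (T : S → A → PMF S) (noop : A) (R : S → A → ℝ) {γ : ℝ} (hγ : |γ| < 1)
    (Raux : ι → S → A → ℝ) (lam : ℝ)
    {Ω : Type*} {mΩ : MeasurableSpace Ω} (μ : Measure Ω) [IsFiniteMeasure μ]
    (ℱ : Filtration ℕ mΩ)
    (X : ℕ → Ω → S) (U : ℕ → Ω → A) (Y : ℕ → Ω → S) (α : ℕ → Ω → ℝ)
    (hexp : AUP.IsExperience μ ℱ T X U Y)
    (hα : AUP.IsLearningRate μ ℱ X U α)
    (Q₀ : ι → S → A → ℝ)
    (Q : ℕ → Ω → ι → S → A → ℝ)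
    (hQ : Q = fun n ω i => AUP.qLearn γ X U Y α (Raux i) (Q₀ i) n ω)
    (scale : (ι → S → A → ℝ) → S → ℝ) (scaleLim : Ω → S → ℝ)
    (hscale : ∀ᵐ ω ∂μ, ∀ s, scaleLim ω s ≠ 0 ∧
      Tendsto (fun n => scale (Q n ω) s) atTop (𝓝 (scaleLim ω s))) :
    ∃ Qstar : ι → S → A → ℝ, (∀ i, AUP.IsOptimalQ T γ (Raux i) (Qstar i)) ∧
      ∀ᵐ ω ∂μ, ∀ s a,
        Tendsto (fun n => AUP.rAUP noop R lam scale (Q n ω) s a) atTop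
          (𝓝 (R s a - lam * (AUP.penalty noop Qstar s a / scaleLim ω s))) := by
  choose Qstar hQstar using fun i => AUP.exists_isOptimalQ T hγ (Raux i)
  have hlearn : ∀ᵐ ω ∂μ, ∀ i,
      Tendsto (fun n => AUP.qLearn γ X U Y α (Raux i) (Q₀ i) n ω) atTop (𝓝 (Qstar i)) :=
    ae_all_iff.2 fun i => AUP.ae_tendsto_qLearn hγ hexp hα (hQstar i)
  subst hQ
  refine ⟨Qstar, hQstar, ?_⟩
  filter_upwards [hlearn, hscale] with ω hω hscaleω s a
  exact AUP.tendsto_rAUP (tendsto_pi_nhds.2 hω) (hscaleω s).2 (hscaleω s).1 a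

theorem mainTheorem2
    {S A ι : Type*} [Fintype S] [DecidableEq S] [Fintype A] [DecidableEq A] [Fintype ι]
    (T : S → A → PMF S) (noop : A) (R : S → A → ℝ) (γ : ℝ) (hγ0 : 0 ≤ γ) (hγ1 : γ < 1)
    (Raux : ι → S → A → ℝ) (lam : ℝ) (hlam : 0 ≤ lam)
    {Ω : Type*} {mΩ : MeasurableSpace Ω} (μ : Measure Ω) [IsProbabilityMeasure μ]
    (ℱ : Filtration ℕ mΩ)
    (X : ℕ → Ω → S) (U : ℕ → Ω → A) (Y : ℕ → Ω → S) (α : ℕ → Ω → ℝ)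
    (hexp : AUP.IsExperience μ ℱ T X U Y)
    (hvisit : AUP.ExploresInfinitely μ X U)
    (hα : AUP.IsLearningRate μ ℱ X U α)
    (Q₀ : ι → S → A → ℝ)
    (Q : ℕ → Ω → ι → S → A → ℝ)
    (hQ : Q = fun n ω i => AUP.qLearn γ X U Y α (Raux i) (Q₀ i) n ω)
    (scale : (ι → S → A → ℝ) → S → ℝ) (scaleLim : Ω → S → ℝ)
    (hscale : ∀ᵐ ω ∂μ, ∀ s, 0 < scaleLim ω s ∧
      Tendsto (fun n => scale (Q n ω) s) atTop (𝓝 (scaleLim ω s))) :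
    ∃ Qstar : ι → S → A → ℝ, (∀ i, AUP.IsOptimalQ T γ (Raux i) (Qstar i)) ∧
      ∀ᵐ ω ∂μ, ∀ s a,
        Tendsto (fun n => AUP.rAUP noop R lam scale (Q n ω) s a) atTop
          (𝓝 (R s a - lam * (AUP.penalty noop Qstar s a / scaleLim ω s))) := by
  exact mainTheorem2_general T noop R (by rwa [abs_of_nonneg hγ0]) Raux lam μ ℱ X U Y α hexp hα Q₀ Q
    hQ scale scaleLim (hscale.mono fun _ h s => ⟨(h s).1.ne', (h s).2⟩)
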